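/- Let $k$ be a field, let $m,n\ge 0$ be integers, and let $I_X=(x_1,\dots,x_m)\subset S=k[x_1,\dots,x_m,z_0,\dots,z_n]$ be the ideal of the linear subspace $X=\mathbb P^n\subset\mathbb P^{n+m}=\operatorname{Proj} S$. Let $J\subset S$ be a saturated monomial ideal whose radical is $I_X$, and let $Y=\operatorname{Proj}(S/J)\subset\mathbb P^{n+m}$ be the closed subscheme that it defines (so $J=I_Y$ and $Y_{\mathrm{red}}=X$). Then the following are equivalent: 1. $Y$ satisfies Serre's condition $(S_1)$, i.e. $\operatorname{depth}\mathcal O_{Y,y}\ge\min(1,\dim\mathcal O_{Y,y})$ for every point $y\in Y$. 2. $Y$ is (locally) Cohen–Macaulay, i.e. all its local rings $\mathcal O_{Y,y}$ are Cohen–Macaulay. 3. $Y$ is arithmetically Cohen–Macaulay, i.e. its homogeneous coordinate ring $S/J$ is a Cohen–Macaulay ring. -/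

import Mathlib

open AlgebraicGeometry

universe u

/-! ### Depth, Cohen-Macaulay rings and schemes, Serre's conditions -/

/-- The depth of a (Noetherian) local ring: the supremum of the lengths of the regular sequences
on `R` that are contained in the maximal ideal. -/
noncomputable def localDepth (R : Type u) [CommRing R] [IsLocalRing R] : ℕ∞ :=
  ⨆ (rs : List R) (_ : (∀ r ∈ rs, r ∈ IsLocalRing.maximalIdeal R) ∧
    RingTheory.Sequence.IsRegular R rs), (rs.length : ℕ∞)

/-- A local ring is Cohen-Macaulay if it is Noetherian and its depth equals its Krull dimension. -/
def IsCohenMacaulayLocal (R : Type u) [CommRing R] [IsLocalRing R] : Prop :=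
  IsNoetherianRing R ∧ (localDepth R : WithBot ℕ∞) = ringKrullDim R

/-- A ring is Cohen-Macaulay if it is Noetherian and all its localizations at prime ideals are
Cohen-Macaulay local rings. -/
def IsCohenMacaulayRing (R : Type u) [CommRing R] : Prop :=
  IsNoetherianRing R ∧
    ∀ (p : Ideal R) [p.IsPrime], IsCohenMacaulayLocal (Localization.AtPrime p)

/-- Serre's condition `(S_r)` for a (locally Noetherian) scheme: every point `x` satisfies
`depth 𝒪_{X,x} ≥ min (r, dim 𝒪_{X,x})`. -/
def SatisfiesSerre (r : ℕ) (X : Scheme.{u}) : Prop :=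
  ∀ x : X, min (r : WithBot ℕ∞) (ringKrullDim (X.presheaf.stalk x)) ≤
    (localDepth (X.presheaf.stalk x) : WithBot ℕ∞)

/-- A scheme is (locally) Cohen-Macaulay if all its local rings are Cohen-Macaulay. -/
def IsLocallyCohenMacaulay (X : Scheme.{u}) : Prop :=
  ∀ x : X, IsCohenMacaulayLocal (X.presheaf.stalk x)

/-! ### The quotient of a graded algebra by a homogeneous ideal -/

section Quotient

variable {R A : Type u} [CommRing R] [CommRing A] [Algebra R A]
  (𝒜 : ℕ → Submodule R A) [GradedAlgebra 𝒜] (I : HomogeneousIdeal 𝒜)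

/-- The grading of `A ⧸ I` induced by that of `A`: the degree `i` part is the image of `𝒜 i`. -/
def quotientGrading (i : ℕ) : Submodule R (A ⧸ I.toIdeal) :=
  (𝒜 i).map (Ideal.Quotient.mkₐ R I.toIdeal).toLinearMap

instance quotientGrading_gradedMonoid : SetLike.GradedMonoid (quotientGrading 𝒜 I) where
  one_mem := ⟨1, SetLike.GradedOne.one_mem, map_one (Ideal.Quotient.mkₐ R I.toIdeal)⟩
  mul_mem := by
    rintro i j _ _ ⟨a, ha, rfl⟩ ⟨b, hb, rfl⟩
    exact ⟨a * b, SetLike.GradedMul.mul_mem ha hb, map_mul (Ideal.Quotient.mkₐ R I.toIdeal) a b⟩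

/-- The map `A → ⨁ i, (A ⧸ I)_i` that sends `a` to the classes of its homogeneous components. -/
noncomputable def quotientDecomposeAux :
    A →ₗ[R] DirectSum ℕ fun i => quotientGrading 𝒜 I i :=
  (DirectSum.lmap fun i => ((Ideal.Quotient.mkₐ R I.toIdeal).toLinearMap.restrict
    (fun a ha => ⟨a, ha, rfl⟩ : ∀ a ∈ 𝒜 i, _ ∈ quotientGrading 𝒜 I i))) ∘ₗ
    (DirectSum.decomposeLinearEquiv 𝒜).toLinearMap

theorem quotientDecomposeAux_apply (a : A) (i : ℕ) :
    (quotientDecomposeAux 𝒜 I a i : A ⧸ I.toIdeal) =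
      Ideal.Quotient.mk I.toIdeal (DirectSum.decompose 𝒜 a i : A) :=
  rfl

theorem quotientDecomposeAux_eq_zero (a : A) (ha : a ∈ I.toIdeal) :
    quotientDecomposeAux 𝒜 I a = 0 := by
  refine DFinsupp.ext fun i => Subtype.ext ?_
  rw [quotientDecomposeAux_apply]
  exact Ideal.Quotient.eq_zero_iff_mem.mpr (I.isHomogeneous i ha)

theorem quotientDecomposeAux_of_mem {i : ℕ} (a : A) (ha : a ∈ 𝒜 i) :
    quotientDecomposeAux 𝒜 I a =
      DirectSum.lof R ℕ (fun i => quotientGrading 𝒜 I i) i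
        ⟨Ideal.Quotient.mk I.toIdeal a, a, ha, rfl⟩ := by
  have h : DirectSum.decomposeLinearEquiv 𝒜 a = DirectSum.lof R ℕ (fun i => 𝒜 i) i ⟨a, ha⟩ :=
    DirectSum.decompose_of_mem 𝒜 ha
  rw [quotientDecomposeAux, LinearMap.comp_apply, LinearEquiv.coe_coe, h, DirectSum.lmap_lof]
  rfl

/-- The decomposition of `A ⧸ I` into its homogeneous components. -/
noncomputable def quotientDecompose :
    (A ⧸ I.toIdeal) →+ DirectSum ℕ fun i => quotientGrading 𝒜 I i :=
  QuotientAddGroup.lift (Submodule.toAddSubgroup I.toIdeal)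
    (quotientDecomposeAux 𝒜 I).toAddMonoidHom (quotientDecomposeAux_eq_zero 𝒜 I)

theorem quotientDecompose_mk (a : A) :
    quotientDecompose 𝒜 I (Ideal.Quotient.mk I.toIdeal a) = quotientDecomposeAux 𝒜 I a :=
  rfl

noncomputable instance quotientGrading_gradedAlgebra : GradedAlgebra (quotientGrading 𝒜 I) where
  __ := quotientGrading_gradedMonoid 𝒜 I
  __ := DirectSum.Decomposition.ofAddHom (quotientGrading 𝒜 I) (quotientDecompose 𝒜 I)
    (by
      refine AddMonoidHom.ext fun x => ?_
      obtain ⟨a, rfl⟩ := Ideal.Quotient.mk_surjective x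
      simp only [AddMonoidHom.comp_apply, quotientDecompose_mk, AddMonoidHom.id_apply]
      induction a using DirectSum.Decomposition.inductionOn 𝒜 with
      | zero => simp
      | homogeneous a =>
        rw [quotientDecomposeAux_of_mem 𝒜 I _ a.2]
        exact DirectSum.coeAddMonoidHom_of _ _ _
      | add a b ha hb => simp only [map_add, ha, hb])
    (by
      refine DirectSum.addHom_ext fun i => ?_
      rintro ⟨_, a, ha, rfl⟩
      rw [AddMonoidHom.comp_apply, DirectSum.coeAddMonoidHom_of, AddMonoidHom.id_apply]
      exact (quotientDecompose_mk 𝒜 I a).trans (quotientDecomposeAux_of_mem 𝒜 I a ha))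

end Quotient

/-! ### Subschemes of projective space and monomial ideals -/

section Projective

attribute [local instance] MvPolynomial.gradedAlgebra

variable {k : Type u} [Field k] {σ : Type}

/-- The closed subscheme of projective space `Proj k[X_s : s ∈ σ]` that is defined by the
homogeneous ideal `J`, namely `Proj (k[X_s : s ∈ σ] ⧸ J)`. -/
noncomputable def projSubscheme (J : HomogeneousIdeal (MvPolynomial.homogeneousSubmodule σ k)) :
    Scheme.{u} :=
  Proj (quotientGrading (MvPolynomial.homogeneousSubmodule σ k) J)

/-- An ideal of a polynomial ring is monomial if it is generated by monomials. -/
def IsMonomialIdeal (J : Ideal (MvPolynomial σ k)) : Prop :=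
  ∃ E : Set (σ →₀ ℕ), J = Ideal.span ((fun e => MvPolynomial.monomial e (1 : k)) '' E)

/-- `J` is saturated: `J = (J : 𝔪^∞)`, where `𝔪` is the ideal generated by all the variables. -/
def IsSaturatedIdeal (J : Ideal (MvPolynomial σ k)) : Prop :=
  ∀ f : MvPolynomial σ k,
    (∃ N : ℕ, ∀ g ∈ (Ideal.span (Set.range MvPolynomial.X) : Ideal (MvPolynomial σ k)) ^ N,
      g * f ∈ J) → f ∈ J

/-- The subscheme of projective space with saturated homogeneous ideal `J` is arithmetically
Cohen-Macaulay if its homogeneous coordinate ring is a Cohen-Macaulay ring. -/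
def IsArithmeticallyCohenMacaulay
    (J : HomogeneousIdeal (MvPolynomial.homogeneousSubmodule σ k)) : Prop :=
  IsCohenMacaulayRing (MvPolynomial σ k ⧸ J.toIdeal)

/-- The ideal `(x_1, …, x_m)` of `k[x_1, …, x_m, z_0, …, z_n]`; here `Sum.inl i` indexes the
variables `x` and `Sum.inr j` the variables `z`. -/
noncomputable def linearSubspaceIdeal (k : Type u) [Field k] (m n : ℕ) :
    Ideal (MvPolynomial (Fin m ⊕ Fin (n + 1)) k) :=
  Ideal.span (Set.range fun i : Fin m => MvPolynomial.X (Sum.inl i))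

end Projective

attribute [local instance] MvPolynomial.gradedAlgebra

/-! Each of the three conditions turns out to be equivalent to `J` being extended from the
`x`-variables, `J = I S` with `I` an ideal of `k[x_1, …, x_m]`. For a monomial ideal this says that
a variable `z_j` can always be cancelled from a monomial of `J`
(`IsMonomialIdeal.eq_map_rename_inl`).

If `J = I S`, then `S/J` is the polynomial ring `(k[x]/I)[z]`, and on the chart `z_j ≠ 0` the stalks
of `Y` are localizations of `(k[x]/I)[z_i : i ≠ j]`. Every prime of `k[x]/I` is nil because the
radical of `J` contains all `x_i`, so the empty sequence is a system of parameters at each prime;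
adjoining variables preserves Cohen–Macaulayness (`HasRegularParametersAtPrimes.mvPolynomial`).

If cancellation fails, some `z_v` kills a monomial that is nonzero modulo `J`. Enlarging the
annihilator as far as possible gives a monomial `e` for which `J : e` is a prime generated by
variables, `z_v` among them (`IsMonomialIdeal.exists_colon_eq_span_X`). Saturation keeps it from
containing all variables, so it is a point of `Y`. The local ring there has depth zero, so `(S_1)`
makes its maximal ideal nil, hence `z_v` nilpotent near the point. But `z_v` is outside the prime
`(x_1, …, x_m) = √J`, a contradiction. The same prime contradicts Cohen–Macaulayness of `S/J`. -/

section RegularParameters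

/-! ### Cohen–Macaulay rings through regular systems of parameters -/

open IsLocalRing RingTheory.Sequence

/-- Some weakly regular sequence in the maximal ideal generates an ideal that is primary to the
maximal ideal. -/
def HasRegularParameters (R : Type*) [CommRing R] [IsLocalRing R] : Prop :=
  ∃ rs : List R, (∀ r ∈ rs, r ∈ maximalIdeal R) ∧ IsWeaklyRegular R rs ∧
    maximalIdeal R ≤ (Ideal.ofList rs).radical

theorem HasRegularParameters.of_maximalIdeal_le_nilradical {R : Type*} [CommRing R] [IsLocalRing R]
    (h : maximalIdeal R ≤ nilradical R) : HasRegularParameters R :=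
  ⟨[], by simp, .nil R R, by simpa [nilradical] using h⟩

theorem HasRegularParameters.of_ringEquiv {R S : Type*} [CommRing R] [IsLocalRing R]
    [CommRing S] [IsLocalRing S] (e : R ≃+* S) (h : HasRegularParameters R) :
    HasRegularParameters S := by
  obtain ⟨rs, hm, hr, hrad⟩ := h
  let := e.toRingHom.toAlgebra
  have : Module.Flat R S := Module.Flat.of_linearEquiv
    (AlgEquiv.ofRingEquiv (f := e) (fun _ => rfl) : R ≃ₐ[R] S).symm.toLinearEquiv
  have hmax : ∀ r, e r ∈ maximalIdeal S ↔ r ∈ maximalIdeal R := fun r => by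
    simp [mem_maximalIdeal, mem_nonunits_iff]
  refine ⟨rs.map (algebraMap R S), ?_, hr.of_flat, ?_⟩
  · intro s hs
    obtain ⟨r, hr, rfl⟩ := List.mem_map.mp hs
    exact (hmax r).mpr (hm r hr)
  · intro s hs
    obtain ⟨r, rfl⟩ := e.surjective s
    obtain ⟨N, hN⟩ := hrad ((hmax r).mp hs)
    refine ⟨N, ?_⟩
    rw [← Ideal.map_ofList, ← map_pow]
    exact Ideal.mem_map_of_mem (algebraMap R S) hN

theorem ringKrullDim_quotient_eq_zero_of_maximalIdeal_le_radical {R : Type*} [CommRing R]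
    [IsLocalRing R] {I : Ideal R} (hI : I ≠ ⊤) (h : maximalIdeal R ≤ I.radical) :
    ringKrullDim (R ⧸ I) = 0 := by
  have : Nontrivial (R ⧸ I) := Ideal.Quotient.nontrivial_iff.mpr hI
  rw [← ringKrullDimZero_iff_ringKrullDim_eq_zero]
  rw [Ideal.krullDimLE_zero_quotient_iff_forall_minimalPrimes_isMaximal]
  intro p hp
  have hpp := hp.1.1
  have : maximalIdeal R ≤ p := h.trans (hpp.radical_le_iff.mpr hp.1.2)
  rw [← (maximalIdeal.isMaximal R).eq_of_le hpp.ne_top this]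
  exact maximalIdeal.isMaximal R

/-- Dividing by a regular sequence lowers the dimension by its length. For the given sequence the
quotient has dimension zero, so its length is `dim R`; for any other one the quotient has
nonnegative dimension, so it is no longer. -/
theorem HasRegularParameters.isCohenMacaulayLocal {R : Type u} [CommRing R] [IsLocalRing R]
    [IsNoetherianRing R] (h : HasRegularParameters R) : IsCohenMacaulayLocal R := by
  refine ⟨inferInstance, ?_⟩
  obtain ⟨rs, hm, hr, hrad⟩ := h
  have hreg : RingTheory.Sequence.IsRegular R rs :=
    (IsLocalRing.isRegular_iff_isWeaklyRegular_of_subset_maximalIdeal hm).mpr hr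
  have htop : Ideal.ofList rs ≠ ⊤ := fun h =>
    (maximalIdeal.isMaximal R).ne_top (top_le_iff.mp (h ▸ Ideal.span_le.mpr hm))
  have hlen : ((rs.length : ℕ∞) : WithBot ℕ∞) = ringKrullDim R := by
    rw [← ringKrullDim_add_length_eq_ringKrullDim_of_isRegular rs hreg,
      ringKrullDim_quotient_eq_zero_of_maximalIdeal_le_radical htop hrad, zero_add]
    rfl
  rw [← hlen, WithBot.coe_inj]
  refine le_antisymm (iSup₂_le fun ss hss => ?_)
    (le_iSup₂_of_le (f := fun (ss : List R) (_ : (∀ r ∈ ss, r ∈ maximalIdeal R) ∧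
      RingTheory.Sequence.IsRegular R ss) => (ss.length : ℕ∞)) rs ⟨hm, hreg⟩ le_rfl)
  have htop' : Ideal.ofList ss ≠ ⊤ := fun h =>
    (maximalIdeal.isMaximal R).ne_top (top_le_iff.mp (h ▸ Ideal.span_le.mpr hss.1))
  have : Nontrivial (R ⧸ Ideal.ofList ss) := Ideal.Quotient.nontrivial_iff.mpr htop'
  rw [← WithBot.coe_le_coe, hlen, ← ringKrullDim_add_length_eq_ringKrullDim_of_isRegular ss hss.2]
  exact le_add_of_nonneg_left ringKrullDim_nonneg_of_nontrivial

/-- No element of the maximal ideal is regular, since all of them kill `w ≠ 0`. The depth is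
therefore zero, and the inequality forces dimension zero. -/
theorem isNilpotent_of_min_one_ringKrullDim_le_localDepth {R : Type u} [CommRing R] [IsLocalRing R]
    (h : min ((1 : ℕ) : WithBot ℕ∞) (ringKrullDim R) ≤ (localDepth R : WithBot ℕ∞))
    {w : R} (hw : w ≠ 0) (hann : ∀ r ∈ maximalIdeal R, r * w = 0) {r : R}
    (hr : r ∈ maximalIdeal R) : IsNilpotent r := by
  have hdepth : localDepth R = 0 := by
    refine le_antisymm (iSup₂_le fun ss hss => ?_) bot_le
    cases ss with
    | nil => simp
    | cons s ss =>
      exfalso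
      have h1 := ((isRegular_cons_iff R s ss).mp hss.2).1
      exact hw (h1 (by simpa using hann s (hss.1 s (by simp))))
  have hdim : ringKrullDim R ≤ 0 := by
    rw [hdepth] at h
    rcases min_le_iff.mp h with h | h
    · exact absurd h (by decide)
    · exact h
  have : Ring.KrullDimLE 0 R := (ringKrullDimZero_iff_ringKrullDim_eq_zero).mpr
    (le_antisymm hdim ringKrullDim_nonneg_of_nontrivial)
  exact Ring.KrullDimLE.isNilpotent_iff_mem_maximalIdeal.mpr hr

/-- Every localization at a prime ideal has a regular sequence of parameters. -/
def HasRegularParametersAtPrimes (R : Type*) [CommRing R] : Prop :=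
  ∀ (p : Ideal R) [p.IsPrime], HasRegularParameters (Localization.AtPrime p)

theorem HasRegularParametersAtPrimes.of_isLocalization {R : Type*} [CommRing R]
    (h : HasRegularParametersAtPrimes R) (p : Ideal R) [p.IsPrime] (S : Type*) [CommRing S]
    [IsLocalRing S] [Algebra R S] [IsLocalization.AtPrime S p] : HasRegularParameters S :=
  (h p).of_ringEquiv (IsLocalization.algEquiv p.primeCompl (Localization.AtPrime p) S).toRingEquiv

theorem HasRegularParametersAtPrimes.of_ringEquiv {R S : Type*} [CommRing R] [CommRing S]
    (e : R ≃+* S) (h : HasRegularParametersAtPrimes R) : HasRegularParametersAtPrimes S := by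
  intro p _
  have := h (p.comap e)
  exact this.of_ringEquiv (Localization.localRingEquiv (p.comap e) p e rfl)

open Polynomial

/-- A prime over `𝔪` is either `𝔪R[X]` or `𝔪R[X] + (f)` with `f` monic, since `R[X]/𝔪R[X]` is a
principal ideal domain. Parameters of `R` suffice in the first case; in the second, `f` is appended.
-/
theorem Polynomial.hasRegularParameters_localization_atPrime {R : Type*} [CommRing R]
    [IsLocalRing R] (h : HasRegularParameters R) (p : Ideal R[X]) [p.IsPrime]
    (hp : p.comap C = maximalIdeal R) : HasRegularParameters (Localization.AtPrime p) := by
  obtain ⟨rs, hm, hr, hrad⟩ := h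
  set T := Localization.AtPrime p
  have hrX : IsWeaklyRegular R[X] (rs.map C) := hr.of_flat
  have hle : (maximalIdeal R).map C ≤ p := by rw [← hp]; exact Ideal.map_comap_le
  have key : ∀ ss : List R[X], (∀ s ∈ ss, s ∈ p) → IsWeaklyRegular R[X] ss →
      p ≤ (Ideal.ofList ss).radical → HasRegularParameters T := by
    intro ss h1 h2 h3
    refine ⟨ss.map (algebraMap R[X] T), ?_, h2.of_isLocalization T p.primeCompl, ?_⟩
    · intro s hs
      obtain ⟨r, hr, rfl⟩ := List.mem_map.mp hs
      exact (IsLocalization.AtPrime.to_map_mem_maximal_iff T p r).mpr (h1 r hr)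
    · rw [← Localization.AtPrime.map_eq_maximalIdeal, ← Ideal.map_ofList]
      exact (Ideal.map_mono h3).trans (Ideal.map_radical_le _)
  have hmap : ∀ s ∈ rs.map C, s ∈ p := by
    intro s hs
    obtain ⟨r, hr, rfl⟩ := List.mem_map.mp hs
    exact hle (Ideal.mem_map_of_mem _ (hm r hr))
  have hmr : (maximalIdeal R).map C ≤ (Ideal.ofList (rs.map C)).radical := by
    rw [← Ideal.map_ofList]
    exact (Ideal.map_mono hrad).trans (Ideal.map_radical_le _)
  by_cases heq : p = (maximalIdeal R).map C
  · exact key (rs.map C) hmap hrX (heq.le.trans hmr)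
  · have hmax : (Ideal.comap C p).IsMaximal := by rw [hp]; exact maximalIdeal.isMaximal R
    obtain ⟨f, hf, hspan⟩ := Polynomial.exists_monic_span_sup_map_eq R p hmax (by simpa [hp])
    rw [hp] at hspan
    refine key (rs.map C ++ [f]) ?_ ?_ ?_
    · intro s hs
      rcases List.mem_append.mp hs with hs | hs
      · exact hmap s hs
      · rw [List.mem_singleton.mp hs, hspan]
        exact Ideal.mem_sup_right (Ideal.mem_span_singleton_self f)
    -- Modulo the earlier elements `R[X]` becomes `(R/(rs))[X]`, where a monic polynomial is still a
    -- nonzerodivisor.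
    · rw [isWeaklyRegular_append_iff, isWeaklyRegular_singleton_iff]
      refine ⟨hrX, ?_⟩
      rw [isSMulRegular_quotient_iff_mem_of_smul_mem]
      intro a ha
      rw [smul_eq_mul, Ideal.mul_top, ← Ideal.map_ofList, ← Ideal.mk_ker (I := Ideal.ofList rs),
        ← Polynomial.ker_mapRingHom, RingHom.mem_ker, Polynomial.coe_mapRingHom] at ha ⊢
      rw [smul_eq_mul, Polynomial.map_mul] at ha
      exact ((hf.map _).mem_nonZeroDivisors.1 _ ha)
    · rw [Ideal.ofList_append, hspan]
      refine sup_le (hmr.trans (Ideal.radical_mono le_sup_left)) ?_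
      rw [Ideal.ofList_singleton]
      exact le_trans le_sup_right Ideal.le_radical

/-- Inverting the constants outside `q = p ∩ R` first makes `R[X]_p` a localization of `R_q[X]` at a
prime over the maximal ideal of `R_q`, which is the local case. -/
theorem HasRegularParametersAtPrimes.polynomial {R : Type*} [CommRing R]
    (h : HasRegularParametersAtPrimes R) : HasRegularParametersAtPrimes R[X] := by
  intro p hp
  let q := p.comap C
  let S := (Localization.AtPrime q)[X]
  let pc := Submonoid.map Polynomial.C.toMonoidHom q.primeCompl
  let : Algebra R[X] S := algebra R (Localization.AtPrime q)
  have : IsLocalization pc S := Polynomial.isLocalization _ _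
  let pS := p.map (algebraMap R[X] S)
  have disj : Disjoint (pc : Set R[X]) (p : Set R[X]) := by
    simpa [pc, q] using! Set.disjoint_image_left.mpr
      (Set.disjoint_compl_left_iff_subset.mpr (fun _ a ↦ a))
  have : pS.IsPrime := IsLocalization.isPrime_of_isPrime_disjoint pc _ _ ‹_› disj
  have : IsLocalization.AtPrime (Localization.AtPrime pS) p := by
    convert IsLocalization.isLocalization_isLocalization_atPrime_isLocalization pc
      (Localization.AtPrime pS) pS
    exact (IsLocalization.under_map_of_isPrime_disjoint pc _ ‹_› disj).symm
  have eq : Ideal.comap C pS = maximalIdeal (Localization.AtPrime q) := by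
    rw [← IsLocalization.map_under q.primeCompl _ (Ideal.comap C pS),
      ← IsLocalization.map_under q.primeCompl _ (maximalIdeal (Localization.AtPrime q))]
    simp only [Ideal.comap_comap, S, pS]
    rw [← Polynomial.algebraMap_eq (R := Localization.AtPrime q),
      ← IsScalarTower.algebraMap_eq R (Localization.AtPrime q) (Localization.AtPrime q)[X],
      IsScalarTower.algebraMap_eq R R[X] (Localization.AtPrime q)[X], ← Ideal.comap_comap,
      ← Ideal.under_def R[X], IsLocalization.under_map_of_isPrime_disjoint pc _ ‹_› disj]
    simp [q, IsLocalization.AtPrime.under_maximalIdeal (Localization.AtPrime q) q]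
  exact (Polynomial.hasRegularParameters_localization_atPrime (h q) pS eq).of_ringEquiv
    (IsLocalization.algEquiv p.primeCompl (Localization.AtPrime pS)
      (Localization.AtPrime p)).toRingEquiv

theorem HasRegularParametersAtPrimes.mvPolynomial {R : Type*} [CommRing R]
    (h : HasRegularParametersAtPrimes R) (ι : Type*) [Finite ι] :
    HasRegularParametersAtPrimes (MvPolynomial ι R) := by
  induction ι using Finite.induction_empty_option with
  | of_equiv e H => exact H.of_ringEquiv (MvPolynomial.renameEquiv _ e).toRingEquiv
  | h_empty => exact h.of_ringEquiv (MvPolynomial.isEmptyRingEquiv R _).symm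
  | h_option IH =>
    exact IH.polynomial.of_ringEquiv (MvPolynomial.optionEquivLeft _ _).toRingEquiv.symm

theorem HasRegularParametersAtPrimes.of_le_nilradical {R : Type*} [CommRing R]
    (h : ∀ p : Ideal R, p.IsPrime → p ≤ nilradical R) : HasRegularParametersAtPrimes R := by
  intro p hp
  refine .of_maximalIdeal_le_nilradical ?_
  rw [← Localization.AtPrime.map_eq_maximalIdeal, Ideal.map_le_iff_le_comap]
  intro x hx
  exact (show IsNilpotent x from h p hp hx).map _

theorem HasRegularParametersAtPrimes.isCohenMacaulayRing {R : Type u} [CommRing R]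
    [IsNoetherianRing R] (h : HasRegularParametersAtPrimes R) : IsCohenMacaulayRing R :=
  ⟨inferInstance, fun p _ =>
    have := IsLocalization.isNoetherianRing p.primeCompl (Localization.AtPrime p) ‹_›
    (h p).isCohenMacaulayLocal⟩

end RegularParameters

/-! ### Monomial ideals and their colon ideals -/

namespace IsMonomialIdeal

open MvPolynomial

variable {k : Type u} [Field k] {σ : Type} {J : Ideal (MvPolynomial σ k)}

theorem mem_iff (hJ : IsMonomialIdeal J) {f : MvPolynomial σ k} :
    f ∈ J ↔ ∀ e ∈ f.support, monomial e (1 : k) ∈ J := by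
  classical
  obtain ⟨E, rfl⟩ := hJ
  simp only [mem_ideal_span_monomial_image]
  refine forall₂_congr fun e _ => ?_
  simp [support_monomial]

/-- The monomial version of the existence of associated primes: among the monomials outside `J` that
`X v` multiplies into `J`, one with maximal colon ideal is chosen. Maximality makes this colon prime
on monomials, so each monomial in it is divisible by a variable in it. -/
theorem exists_colon_eq_span_X [Finite σ] (hJ : IsMonomialIdeal J) {v : σ} {d : σ →₀ ℕ}
    (hd : monomial d (1 : k) ∉ J) (hv : monomial (d + Finsupp.single v 1) (1 : k) ∈ J) :
    ∃ (Z : Set σ) (e : σ →₀ ℕ), monomial e (1 : k) ∉ J ∧ v ∈ Z ∧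
      ∀ f : MvPolynomial σ k, f * monomial e 1 ∈ J ↔ f ∈ Ideal.span (X '' Z) := by
  classical
  let colon (e : σ →₀ ℕ) : Ideal (MvPolynomial σ k) :=
    Submodule.comap (LinearMap.mulRight (MvPolynomial σ k) (monomial e (1 : k))) J
  have hcolon : ∀ e f, f ∈ colon e ↔ f * monomial e 1 ∈ J := fun e f => Iff.rfl
  have hmon : ∀ a b : σ →₀ ℕ, monomial a (1 : k) * monomial b 1 = monomial (a + b) 1 :=
    fun a b => by rw [monomial_mul, one_mul]
  obtain ⟨e, ⟨he, hev⟩, hmax⟩ := WellFounded.has_min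
    (InvImage.wf colon (wellFounded_gt (α := Ideal (MvPolynomial σ k))))
    {e | monomial e (1 : k) ∉ J ∧ monomial (e + Finsupp.single v 1) (1 : k) ∈ J} ⟨d, hd, hv⟩
  -- If `a + e` is outside `J`, it is again a candidate and its colon contains that of `e`; by
  -- maximality the two colons agree.
  have hprime : ∀ a b : σ →₀ ℕ, monomial (a + b + e) (1 : k) ∈ J → monomial (a + e) (1 : k) ∉ J →
      monomial (b + e) (1 : k) ∈ J := by
    intro a b hab ha
    have hle : colon e ≤ colon (a + e) := fun f hf => by
      rw [hcolon] at hf ⊢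
      rw [← hmon, mul_left_comm]
      exact J.mul_mem_left _ hf
    have hav : monomial (a + e + Finsupp.single v 1) (1 : k) ∈ J := by
      rw [add_assoc, ← hmon]
      exact J.mul_mem_left _ hev
    have heq : colon e = colon (a + e) :=
      hle.eq_of_not_lt fun hlt => hmax _ ⟨ha, hav⟩ hlt
    rw [← hmon, ← hcolon, heq, hcolon, hmon]
    rwa [add_left_comm, ← add_assoc]
  have hpow : ∀ w n, monomial (Finsupp.single w n + e) (1 : k) ∈ J →
      monomial (Finsupp.single w 1 + e) (1 : k) ∈ J := by
    intro w n
    induction n with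
    | zero => intro h; exact absurd (by simpa using h) he
    | succ n ih =>
      intro h
      rw [Finsupp.single_add] at h
      by_cases h' : monomial (Finsupp.single w n + e) (1 : k) ∈ J
      · exact ih h'
      · exact hprime _ _ h h'
  have hex : ∀ a : σ →₀ ℕ, monomial (a + e) (1 : k) ∈ J →
      ∃ w, monomial (Finsupp.single w 1 + e) (1 : k) ∈ J ∧ a w ≠ 0 := by
    intro a
    induction a using Finsupp.induction_linear with
    | zero => intro h; exact absurd (by simpa using h) he
    | add a b iha ihb =>
      intro h
      by_cases h' : monomial (a + e) (1 : k) ∈ J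
      · obtain ⟨w, hw, hw'⟩ := iha h'
        exact ⟨w, hw, by simp [hw']⟩
      · obtain ⟨w, hw, hw'⟩ := ihb (hprime _ _ h h')
        exact ⟨w, hw, by simp [hw']⟩
    | single w n =>
      intro h
      refine ⟨w, hpow w n h, ?_⟩
      rintro h0
      rw [Finsupp.single_eq_same] at h0
      exact he (by simpa [h0] using h)
  refine ⟨{w | monomial (Finsupp.single w 1 + e) (1 : k) ∈ J}, e, he, by
    simpa [add_comm] using hev, fun f => ⟨fun hf => ?_, fun hf => ?_⟩⟩
  · rw [mem_ideal_span_X_image]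
    intro a ha
    refine hex a (hJ.mem_iff.mp hf (a + e) ?_)
    rw [mem_support_iff, coeff_mul_monomial, mul_one]
    exact mem_support_iff.mp ha
  · rw [← hcolon]
    revert f
    change Ideal.span _ ≤ colon e
    rw [Ideal.span_le]
    rintro _ ⟨w, hw, rfl⟩
    rw [SetLike.mem_coe, hcolon, X, hmon]
    exact hw

end IsMonomialIdeal

namespace MvPolynomial

/-- The ideal is the kernel of the substitution sending the variables in `Z` to zero, whose target
is a domain. -/
theorem isPrime_span_X_image (k : Type*) [Field k] {σ : Type*} (Z : Set σ) :
    (Ideal.span (X '' Z) : Ideal (MvPolynomial σ k)).IsPrime := by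
  classical
  let φ : MvPolynomial σ k →ₐ[k] MvPolynomial σ k := aeval fun w => if w ∈ Z then 0 else X w
  suffices h : Ideal.span (X '' Z) = RingHom.ker φ by
    rw [h]; exact RingHom.ker_isPrime _
  have hφ : ∀ f, f - φ f ∈ Ideal.span (X '' Z : Set (MvPolynomial σ k)) := by
    intro f
    rw [← Ideal.Quotient.eq]
    have : (Ideal.Quotient.mkₐ k (Ideal.span (X '' Z))) =
        (Ideal.Quotient.mkₐ k (Ideal.span (X '' Z))).comp φ := by
      refine algHom_ext fun w => ?_
      by_cases hw : w ∈ Z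
      · simp only [φ, AlgHom.comp_apply, aeval_X, if_pos hw, map_zero]
        exact Ideal.Quotient.eq_zero_iff_mem.mpr (Ideal.subset_span ⟨w, hw, rfl⟩)
      · simp [φ, hw]
    exact DFunLike.congr_fun this f
  refine le_antisymm ?_ fun f hf => ?_
  · rw [Ideal.span_le]
    rintro _ ⟨w, hw, rfl⟩
    simp [φ, hw]
  · have := hφ f
    rwa [(RingHom.mem_ker).mp hf, sub_zero] at this

end MvPolynomial

/-! ### Ideals extended from the first block of variables -/

section Cone

open MvPolynomial

variable {k : Type u} [Field k] {τ υ : Type} {J : Ideal (MvPolynomial (τ ⊕ υ) k)}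

/-- Each monomial of `J` factors into a first-block and a second-block part; cancelling the
second-block variables one by one leaves the first part in `J`. -/
theorem IsMonomialIdeal.eq_map_rename_inl (hJ : IsMonomialIdeal J)
    (h : ∀ (j : υ) (d : τ ⊕ υ →₀ ℕ), monomial (d + Finsupp.single (.inr j) 1) (1 : k) ∈ J →
      monomial d (1 : k) ∈ J) :
    J = (J.comap (rename (R := k) (Sum.inl : τ → τ ⊕ υ))).map
      (rename (R := k) (Sum.inl : τ → τ ⊕ υ)) := by
  classical
  have hmon : ∀ a b : τ ⊕ υ →₀ ℕ, monomial a (1 : k) * monomial b 1 = monomial (a + b) 1 :=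
    fun a b => by rw [monomial_mul, one_mul]
  have hsingle : ∀ (n : ℕ) (j : υ) (d : τ ⊕ υ →₀ ℕ),
      monomial (d + Finsupp.single (.inr j) n) (1 : k) ∈ J → monomial d (1 : k) ∈ J := by
    intro n j
    induction n with
    | zero => intro d hd; simpa using hd
    | succ n ih =>
      intro d hd
      rw [Finsupp.single_add, ← add_assoc] at hd
      exact ih d (h j _ hd)
  have hinr : ∀ (b : υ →₀ ℕ) (d : τ ⊕ υ →₀ ℕ),
      monomial (d + b.mapDomain Sum.inr) (1 : k) ∈ J → monomial d (1 : k) ∈ J := by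
    intro b
    induction b using Finsupp.induction_linear with
    | zero => intro d hd; simpa using hd
    | add a b iha ihb =>
      intro d hd
      rw [Finsupp.mapDomain_add, ← add_assoc] at hd
      exact iha d (ihb _ hd)
    | single j n =>
      intro d hd
      rw [Finsupp.mapDomain_single] at hd
      exact hsingle n j d hd
  refine le_antisymm (fun f hf => ?_) Ideal.map_comap_le
  rw [f.as_sum]
  refine Ideal.sum_mem _ fun e he => ?_
  obtain ⟨⟨a, b⟩, rfl⟩ := Finsupp.sumFinsuppEquivProdFinsupp.symm.surjective e
  have hab : Finsupp.sumFinsuppEquivProdFinsupp.symm (a, b) =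
      a.mapDomain Sum.inl + b.mapDomain (Sum.inr : υ → τ ⊕ υ) := by
    ext (i | i)
    · simp [Finsupp.mapDomain_apply Sum.inl_injective, Finsupp.mapDomain_of_notMem_range]
    · simp [Finsupp.mapDomain_apply Sum.inr_injective, Finsupp.mapDomain_of_notMem_range]
  have he' := hJ.mem_iff.mp hf _ he
  rw [hab] at he' ⊢
  rw [← mul_one (coeff _ f), ← C_mul_monomial, ← hmon]
  refine Ideal.mul_mem_left _ _ (Ideal.mul_mem_right _ _ ?_)
  rw [← rename_monomial]
  refine Ideal.mem_map_of_mem _ ?_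
  rw [Ideal.mem_comap, rename_monomial]
  exact hinr b _ he'

/-- Modulo `I` every polynomial differs from its constant term by a nilpotent. For an element of a
prime, that constant also lies in the prime, so it vanishes. -/
theorem MvPolynomial.le_nilradical_quotient_of_isPrime {I : Ideal (MvPolynomial τ k)}
    (hI : ∀ i, X i ∈ I.radical) (p : Ideal (MvPolynomial τ k ⧸ I)) (hp : p.IsPrime) :
    p ≤ nilradical (MvPolynomial τ k ⧸ I) := by
  have hnil : ∀ f : MvPolynomial τ k,
      Ideal.Quotient.mk I (f - C (constantCoeff f)) ∈ nilradical (MvPolynomial τ k ⧸ I) := by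
    intro f
    rw [map_sub, ← Ideal.Quotient.eq]
    have : ((Ideal.Quotient.mkₐ k (nilradical (MvPolynomial τ k ⧸ I))).comp
        (Ideal.Quotient.mkₐ k I)) = ((Ideal.Quotient.mkₐ k
          (nilradical (MvPolynomial τ k ⧸ I))).comp (Ideal.Quotient.mkₐ k I)).comp
          ((Algebra.ofId k (MvPolynomial τ k)).comp (aeval (fun _ => 0))) := by
      refine algHom_ext fun i => ?_
      simp only [AlgHom.comp_apply, aeval_X, map_zero]
      refine Ideal.Quotient.eq_zero_iff_mem.mpr ?_
      obtain ⟨N, hN⟩ := hI i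
      exact ⟨N, by simpa using Ideal.Quotient.eq_zero_iff_mem.mpr hN⟩
    have h2 := DFunLike.congr_fun this f
    simpa [aeval_zero', Algebra.ofId_apply, MvPolynomial.algebraMap_eq] using h2
  intro b hb
  obtain ⟨f, rfl⟩ := Ideal.Quotient.mk_surjective b
  have h1 := hnil f
  have h2 : Ideal.Quotient.mk I (C (constantCoeff f)) ∈ p := by
    have := p.sub_mem hb (nilradical_le_prime p h1)
    simpa using this
  have h3 : constantCoeff f = 0 := by
    by_contra hne
    refine hp.ne_top (Ideal.eq_top_of_isUnit_mem _ h2 ?_)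
    exact ((Ne.isUnit hne).map C).map _
  simpa [h3] using h1

/-- The quotient by an ideal extended from the first block of variables is a polynomial ring over
the quotient of the polynomial ring in that block. -/
noncomputable def MvPolynomial.quotientMapRenameInlEquiv (I : Ideal (MvPolynomial τ k)) :
    MvPolynomial υ (MvPolynomial τ k ⧸ I) ≃+*
      MvPolynomial (τ ⊕ υ) k ⧸ I.map (rename (R := k) (Sum.inl : τ → τ ⊕ υ)) :=
  (quotientEquivQuotientMvPolynomial (σ := υ) I).toRingEquiv.trans <|
    Ideal.quotientEquiv (I.map (C : _ →+* MvPolynomial υ (MvPolynomial τ k)))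
      (I.map (rename (R := k) (Sum.inl : τ → τ ⊕ υ)))
      ((sumAlgEquiv k υ τ).symm.trans (renameEquiv k (Equiv.sumComm υ τ))).toRingEquiv (by
        rw [Ideal.map_map, ← Ideal.map_coe (rename _)]
        congr 1
        refine ringHom_ext (fun r => ?_) fun i => ?_
        · simp
        · simp)

end Cone

open IsLocalRing

/-! ### Dehomogenization of homogeneous localizations -/

section GradedLocalization

variable {R A : Type*} [CommRing R] [CommRing A] [Algebra R A] {ℬ : ℕ → Submodule R A}
  [GradedAlgebra ℬ] {p : Ideal A} [p.IsPrime]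

theorem HomogeneousLocalization.AtPrime.isUnit_mk_iff
    (z : HomogeneousLocalization.NumDenSameDeg ℬ p.primeCompl) :
    IsUnit (HomogeneousLocalization.mk z : HomogeneousLocalization.AtPrime ℬ p) ↔
      (z.num : A) ∉ p := by
  rw [← HomogeneousLocalization.isUnit_iff_isUnit_val, HomogeneousLocalization.val_mk,
    Localization.mk_eq_mk', IsLocalization.AtPrime.isUnit_mk'_iff _ p]
  rfl

/-- Here `F` plays the role of setting `t = 1`. A degree-zero fraction `a/s` equals
`(a/t^d)/(s/t^d)`, a quotient of images of `F a` and `F s`, so the stalk is a localization of the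
chart ring `C`. -/
theorem HomogeneousLocalization.isLocalization_atPrime_of_dehomogenization {t : A}
    (ht : t ∈ ℬ 1) (htp : t ∉ p) {C : Type*} [CommRing C] (F : A →+* C)
    (hF : Function.Surjective F) (hFt : F t = 1)
    [Algebra C (HomogeneousLocalization.AtPrime ℬ p)]
    (hφ : ∀ d, ∀ a ∈ ℬ d, (algebraMap C (HomogeneousLocalization.AtPrime ℬ p) (F a)).val =
      Localization.mk a (⟨t, htp⟩ ^ d)) :
    IsLocalization.AtPrime (HomogeneousLocalization.AtPrime ℬ p)
      ((maximalIdeal (HomogeneousLocalization.AtPrime ℬ p)).comap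
        (algebraMap C (HomogeneousLocalization.AtPrime ℬ p))) := by
  set φ := algebraMap C (HomogeneousLocalization.AtPrime ℬ p)
  have hpow : ∀ d, t ^ d ∈ ℬ d := fun d => by simpa using SetLike.pow_mem_graded d ht
  have hmk : ∀ d a (ha : a ∈ ℬ d), φ (F a) = HomogeneousLocalization.mk
      ⟨d, ⟨a, ha⟩, ⟨t ^ d, hpow d⟩, p.primeCompl.pow_mem htp d⟩ := by
    intro d a ha
    apply HomogeneousLocalization.val_injective
    rw [hφ d a ha, HomogeneousLocalization.val_mk]
    rfl
  have hunit : ∀ d a, a ∈ ℬ d → a ∉ p →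
      F a ∈ ((maximalIdeal (HomogeneousLocalization.AtPrime ℬ p)).comap φ).primeCompl := by
    intro d a ha hap hmem
    rw [SetLike.mem_coe, Ideal.mem_comap, mem_maximalIdeal, mem_nonunits_iff, hmk d a ha,
      HomogeneousLocalization.AtPrime.isUnit_mk_iff] at hmem
    exact hmem hap
  -- Components are padded to a common degree with powers of `t`, which `F` does not see.
  have hhom : ∀ g : A, ∃ (d : ℕ) (g' : A), g' ∈ ℬ d ∧ F g' = F g := by
    classical
    intro g
    refine ⟨(DirectSum.decompose ℬ g).support.sup id, ∑ i ∈ (DirectSum.decompose ℬ g).support,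
      t ^ ((DirectSum.decompose ℬ g).support.sup id - i) * DirectSum.decompose ℬ g i, ?_, ?_⟩
    · refine Submodule.sum_mem _ fun i hi => ?_
      have hle : i ≤ (DirectSum.decompose ℬ g).support.sup id :=
        Finset.le_sup (f := id) hi
      have := SetLike.mul_mem_graded (hpow ((DirectSum.decompose ℬ g).support.sup id - i))
        (DirectSum.decompose ℬ g i).2
      rwa [Nat.sub_add_cancel hle] at this
    · conv_rhs => rw [← DirectSum.sum_support_decompose ℬ g]
      simp [hFt]
  refine ⟨fun c => ?_, fun z => ?_, fun {x y} hxy => ?_⟩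
  · have := c.2
    by_contra hc
    exact this hc
  · obtain ⟨⟨d, ⟨a, ha⟩, ⟨s, hs⟩, hsp⟩, rfl⟩ := HomogeneousLocalization.mk_surjective z
    refine ⟨(F a, ⟨F s, hunit d s hs hsp⟩), ?_⟩
    apply HomogeneousLocalization.val_injective
    rw [HomogeneousLocalization.val_mul, HomogeneousLocalization.val_mk]
    change Localization.mk a _ * (φ (F s)).val = (φ (F a)).val
    rw [hφ d a ha, hφ d s hs, Localization.mk_mul, Localization.mk_eq_mk_iff,
      Localization.r_iff_exists]
    refine ⟨1, ?_⟩
    simp only [Submonoid.coe_mul, Submonoid.coe_one]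
    ring
  · obtain ⟨g, hg⟩ := hF (x - y)
    obtain ⟨d, g', hg'd, hg'⟩ := hhom g
    have h0 : (φ (F g')).val = 0 := by
      rw [hg', hg, map_sub, hxy, sub_self, HomogeneousLocalization.val_zero]
    rw [hφ d g' hg'd, Localization.mk_eq_mk', IsLocalization.mk'_eq_zero_iff] at h0
    obtain ⟨⟨s, hsp⟩, hs⟩ := h0
    -- The denominator `s` need not be homogeneous, but one of its components avoids `p`, and each
    -- component kills the homogeneous `g'` because `s` does.
    have hex : ∃ i, (DirectSum.decompose ℬ s i : A) ∉ p := by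
      classical
      by_contra! hcon
      refine hsp ?_
      rw [← DirectSum.sum_support_decompose ℬ s]
      exact Ideal.sum_mem _ fun i _ => hcon i
    obtain ⟨i, hi⟩ := hex
    have hzero : (DirectSum.decompose ℬ s i : A) * g' = 0 := by
      rw [← DirectSum.coe_decompose_mul_add_of_right_mem ℬ hg'd]
      simp only at hs
      rw [hs, DirectSum.decompose_zero]
      rfl
    refine ⟨⟨F (DirectSum.decompose ℬ s i), hunit i _ (DirectSum.decompose ℬ s i).2 hi⟩, ?_⟩
    rw [← sub_eq_zero, ← mul_sub, ← hg, ← hg', ← map_mul, hzero, map_zero]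

end GradedLocalization

/-! ### Associated primes and nilpotence under depth conditions -/

section EmbeddedPrime

/-- As `p` is the annihilator of `w`, the image of `w` in `A_p` is nonzero and killed by the maximal
ideal. Depth equal to dimension then makes `a` nilpotent in `A_p`. -/
theorem exists_mul_pow_eq_zero_of_isCohenMacaulayRing {A : Type u} [CommRing A]
    (h : IsCohenMacaulayRing A) (p : Ideal A) [p.IsPrime] {w : A} (hw : ∀ a, a * w = 0 ↔ a ∈ p)
    {a : A} (ha : a ∈ p) : ∃ c ∉ p, ∃ N : ℕ, c * a ^ N = 0 := by
  set T := Localization.AtPrime p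
  have hne : algebraMap A T w ≠ 0 := by
    intro h0
    obtain ⟨⟨c, hc⟩, hcw⟩ := (IsLocalization.map_eq_zero_iff p.primeCompl T w).mp h0
    exact hc ((hw c).mp hcw)
  have hann : ∀ r ∈ maximalIdeal T, r * algebraMap A T w = 0 := by
    intro r hr
    rw [← Localization.AtPrime.map_eq_maximalIdeal] at hr
    refine Submodule.span_induction (p := fun r _ => r * algebraMap A T w = 0) ?_ ?_ ?_ ?_ hr
    · rintro _ ⟨b, hb, rfl⟩
      rw [← map_mul, (hw b).mpr hb, map_zero]
    · exact zero_mul _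
    · intro x y _ _ hx hy
      rw [add_mul, hx, hy, add_zero]
    · intro c x _ hx
      rw [smul_mul_assoc, hx, smul_zero]
  have hS : min ((1 : ℕ) : WithBot ℕ∞) (ringKrullDim T) ≤ (localDepth T : WithBot ℕ∞) := by
    rw [(h.2 p).2]
    exact min_le_right _ _
  obtain ⟨N, hN⟩ := isNilpotent_of_min_one_ringKrullDim_le_localDepth hS hne hann
    ((IsLocalization.AtPrime.to_map_mem_maximal_iff T p a).mpr ha)
  rw [← map_pow] at hN
  obtain ⟨⟨c, hc⟩, hca⟩ := (IsLocalization.map_eq_zero_iff p.primeCompl T _).mp hN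
  exact ⟨c, hc, N, hca⟩

/-- The projective analogue: `w` and `a` are brought to degree zero by dividing by powers of `t`,
and `w / t^d` is killed by the maximal ideal of the stalk. -/
theorem exists_mul_pow_eq_zero_of_homogeneousLocalization {R : Type*} {A : Type u} [CommRing R]
    [CommRing A] [Algebra R A] {ℬ : ℕ → Submodule R A} [GradedAlgebra ℬ] (p : Ideal A) [p.IsPrime]
    (hS : min ((1 : ℕ) : WithBot ℕ∞) (ringKrullDim (HomogeneousLocalization.AtPrime ℬ p)) ≤
      (localDepth (HomogeneousLocalization.AtPrime ℬ p) : WithBot ℕ∞))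
    {t : A} (ht : t ∈ ℬ 1) (htp : t ∉ p) {d : ℕ} {w : A} (hwd : w ∈ ℬ d)
    (hw : ∀ a, a * w = 0 ↔ a ∈ p) {a : A} (had : a ∈ ℬ 1) (ha : a ∈ p) :
    ∃ c ∉ p, ∃ N : ℕ, c * a ^ N = 0 := by
  have hpow : ∀ d, t ^ d ∈ ℬ d := fun d => by simpa using SetLike.pow_mem_graded d ht
  let w' : HomogeneousLocalization.AtPrime ℬ p := HomogeneousLocalization.mk
    ⟨d, ⟨w, hwd⟩, ⟨t ^ d, hpow d⟩, p.primeCompl.pow_mem htp d⟩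
  let a' : HomogeneousLocalization.AtPrime ℬ p := HomogeneousLocalization.mk
    ⟨1, ⟨a, had⟩, ⟨t, ht⟩, htp⟩
  have hne : w' ≠ 0 := by
    intro h0
    have h1 : w'.val = 0 := by rw [h0, HomogeneousLocalization.val_zero]
    rw [HomogeneousLocalization.val_mk, Localization.mk_eq_mk',
      IsLocalization.mk'_eq_zero_iff] at h1
    obtain ⟨⟨c, hc⟩, hcw⟩ := h1
    exact hc ((hw c).mp hcw)
  have hann : ∀ r ∈ maximalIdeal (HomogeneousLocalization.AtPrime ℬ p), r * w' = 0 := by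
    intro r hr
    obtain ⟨z, rfl⟩ := HomogeneousLocalization.mk_surjective r
    rw [mem_maximalIdeal, mem_nonunits_iff, HomogeneousLocalization.AtPrime.isUnit_mk_iff,
      not_not] at hr
    apply HomogeneousLocalization.val_injective
    rw [HomogeneousLocalization.val_mul, HomogeneousLocalization.val_mk,
      HomogeneousLocalization.val_mk, Localization.mk_mul, HomogeneousLocalization.val_zero]
    change Localization.mk (z.num * w) _ = 0
    rw [(hw _).mpr hr, Localization.mk_zero]
  have ha' : a' ∈ maximalIdeal (HomogeneousLocalization.AtPrime ℬ p) := by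
    rw [mem_maximalIdeal, mem_nonunits_iff, HomogeneousLocalization.AtPrime.isUnit_mk_iff, not_not]
    exact ha
  obtain ⟨N, hN⟩ := isNilpotent_of_min_one_ringKrullDim_le_localDepth hS hne hann ha'
  have h1 : (a' ^ N).val = 0 := by rw [hN, HomogeneousLocalization.val_zero]
  rw [HomogeneousLocalization.val_pow, HomogeneousLocalization.val_mk, Localization.mk_pow,
    Localization.mk_eq_mk', IsLocalization.mk'_eq_zero_iff] at h1
  obtain ⟨⟨c, hc⟩, hca⟩ := h1
  exact ⟨c, hc, N, hca⟩

end EmbeddedPrime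

open MvPolynomial

theorem MvPolynomial.IsHomogeneous.map_mul_pow_eq {k σ L : Type*} [CommSemiring k] [CommSemiring L]
    {D ι : MvPolynomial σ k →+* L} {u : L} (hC : ∀ r, D (C r) = ι (C r))
    (hX : ∀ w, D (X w) * u = ι (X w)) {f : MvPolynomial σ k} {d : ℕ} (hf : f.IsHomogeneous d) :
    D f * u ^ d = ι f := by
  have hmon : ∀ e : σ →₀ ℕ, D (monomial e 1) * u ^ e.degree = ι (monomial e 1) := by
    intro e
    induction e using Finsupp.induction_linear with
    | zero => rw [map_zero, pow_zero, mul_one]; exact hC 1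
    | add a b ha hb =>
      have hab : monomial (a + b) (1 : k) = monomial a 1 * monomial b 1 := by
        rw [monomial_mul, mul_one]
      rw [hab, map_mul, map_mul, ← ha, ← hb, map_add, pow_add]
      ring
    | single w n =>
      rw [← X_pow_eq_monomial, map_pow, map_pow, ← hX w, Finsupp.degree_single, mul_pow]
  rw [f.as_sum, map_sum, map_sum, Finset.sum_mul]
  refine Finset.sum_congr rfl fun e he => ?_
  have hed : e.degree = d := by
    by_contra hne
    exact mem_support_iff.mp he (hf.coeff_eq_zero hne)
  rw [← mul_one (coeff e f), ← C_mul_monomial, map_mul, map_mul, hC, ← hmon e, hed, mul_assoc]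

/-! ### Division by a variable in a homogeneous coordinate ring -/

section Dehomogenization

variable {k : Type u} [Field k] {σ : Type} {J : HomogeneousIdeal (homogeneousSubmodule σ k)}

theorem mk_mem_quotientGrading {f : MvPolynomial σ k} {d : ℕ} (hf : f.IsHomogeneous d) :
    Ideal.Quotient.mk J.toIdeal f ∈ quotientGrading (homogeneousSubmodule σ k) J d :=
  ⟨f, hf, rfl⟩

variable {p : Ideal (MvPolynomial σ k ⧸ J.toIdeal)} [p.IsPrime] {v : σ}

/-- The map to the homogeneous localization that sends each variable `X w` to `X w / X v`. -/
noncomputable def divVariable (hv : Ideal.Quotient.mk J.toIdeal (X v) ∉ p) :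
    MvPolynomial σ k →+*
      HomogeneousLocalization.AtPrime (quotientGrading (homogeneousSubmodule σ k) J) p :=
  eval₂Hom ((HomogeneousLocalization.fromZeroRingHom
      (quotientGrading (homogeneousSubmodule σ k) J) p.primeCompl).comp
      (algebraMap k (quotientGrading (homogeneousSubmodule σ k) J 0)))
    fun w => HomogeneousLocalization.mk ⟨1,
      ⟨_, mk_mem_quotientGrading (isHomogeneous_X k w)⟩,
      ⟨_, mk_mem_quotientGrading (isHomogeneous_X k v)⟩, hv⟩

theorem divVariable_X_self (hv : Ideal.Quotient.mk J.toIdeal (X v) ∉ p) :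
    divVariable hv (X v) = 1 := by
  apply HomogeneousLocalization.val_injective
  rw [divVariable, eval₂Hom_X', HomogeneousLocalization.val_mk, HomogeneousLocalization.val_one]
  exact Localization.mk_self (⟨_, hv⟩ : p.primeCompl)

theorem val_divVariable (hv : Ideal.Quotient.mk J.toIdeal (X v) ∉ p) {f : MvPolynomial σ k}
    {d : ℕ} (hf : f.IsHomogeneous d) :
    (divVariable hv f).val =
      Localization.mk (Ideal.Quotient.mk J.toIdeal f) ((⟨_, hv⟩ : p.primeCompl) ^ d) := by
  let ι : MvPolynomial σ k →+* Localization p.primeCompl :=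
    (algebraMap _ _).comp (Ideal.Quotient.mk J.toIdeal)
  let D : MvPolynomial σ k →+* Localization p.primeCompl :=
    (algebraMap _ _).comp (divVariable hv)
  have hC : ∀ r, D (C r) = ι (C r) := by
    intro r
    change (divVariable hv (C r)).val = _
    rw [divVariable, eval₂Hom_C]
    exact Localization.mk_one_eq_algebraMap _
  have hX : ∀ w, D (X w) * ι (X v) = ι (X w) := by
    intro w
    change (divVariable hv (X w)).val * _ = _
    rw [divVariable, eval₂Hom_X', HomogeneousLocalization.val_mk, Localization.mk_eq_mk']
    exact IsLocalization.mk'_spec (Localization p.primeCompl) _ (⟨_, hv⟩ : p.primeCompl)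
  have key := hf.map_mul_pow_eq (D := D) (ι := ι) (u := ι (X v)) hC hX
  rw [Localization.mk_eq_mk', IsLocalization.eq_mk'_iff_mul_eq]
  refine Eq.trans ?_ key
  rw [SubmonoidClass.coe_pow, map_pow]
  rfl

theorem divVariable_eq_zero (hv : Ideal.Quotient.mk J.toIdeal (X v) ∉ p) {f : MvPolynomial σ k}
    (hf : f ∈ J.toIdeal) : divVariable hv f = 0 := by
  rw [← sum_homogeneousComponent f, map_sum]
  refine Finset.sum_eq_zero fun i _ => ?_
  apply HomogeneousLocalization.val_injective
  rw [val_divVariable hv (homogeneousComponent_isHomogeneous i f),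
    HomogeneousLocalization.val_zero]
  have : homogeneousComponent i f ∈ J.toIdeal := by
    have := J.isHomogeneous i hf
    rwa [← MvPolynomial.decomposition.decompose'_apply]
  rw [Ideal.Quotient.eq_zero_iff_mem.mpr this, Localization.mk_zero]

end Dehomogenization

/-! ### Stalks of a cone on the charts of the second block -/

section Stalks

variable {k : Type u} [Field k] {τ υ : Type}

open Classical in
/-- The map that reduces the polynomials in the first block of variables modulo `I` and sets the
variable `j` of the second block to `1`. -/
noncomputable def setVariableOne (I : Ideal (MvPolynomial τ k)) (j : υ) :
    MvPolynomial (τ ⊕ υ) k →ₐ[k] MvPolynomial {i : υ // i ≠ j} (MvPolynomial τ k ⧸ I) :=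
  aeval (Sum.elim (fun i => C (Ideal.Quotient.mk I (X i)))
    fun i => if h : i = j then 1 else X ⟨i, h⟩)

theorem setVariableOne_X_self (I : Ideal (MvPolynomial τ k)) (j : υ) :
    setVariableOne I j (X (.inr j)) = 1 := by
  simp [setVariableOne]

theorem setVariableOne_X_of_ne (I : Ideal (MvPolynomial τ k)) {i j : υ} (h : i ≠ j) :
    setVariableOne I j (X (.inr i)) = X ⟨i, h⟩ := by
  simp [setVariableOne, h]

theorem setVariableOne_rename_inl (I : Ideal (MvPolynomial τ k)) (j : υ) (g : MvPolynomial τ k) :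
    setVariableOne I j (rename Sum.inl g) = C (Ideal.Quotient.mk I g) := by
  have : (setVariableOne I j).comp (rename Sum.inl) =
      (IsScalarTower.toAlgHom k (MvPolynomial τ k ⧸ I) _).comp (Ideal.Quotient.mkₐ k I) := by
    refine algHom_ext fun i => ?_
    simp [setVariableOne, MvPolynomial.algebraMap_eq]
  simpa [MvPolynomial.algebraMap_eq] using DFunLike.congr_fun this g

theorem setVariableOne_surjective (I : Ideal (MvPolynomial τ k)) (j : υ) :
    Function.Surjective (setVariableOne I j) := by
  intro s
  induction s using MvPolynomial.induction_on with
  | C b =>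
    obtain ⟨g, rfl⟩ := Ideal.Quotient.mk_surjective b
    exact ⟨_, setVariableOne_rename_inl I j g⟩
  | add a b ha hb =>
    obtain ⟨a, rfl⟩ := ha
    obtain ⟨b, rfl⟩ := hb
    exact ⟨a + b, map_add _ _ _⟩
  | mul_X a i ha =>
    obtain ⟨a, rfl⟩ := ha
    exact ⟨a * X (.inr i.1), by rw [map_mul, setVariableOne_X_of_ne I i.2]⟩

theorem setVariableOne_eq_zero {I : Ideal (MvPolynomial τ k)} (j : υ)
    {f : MvPolynomial (τ ⊕ υ) k} (hf : f ∈ I.map (rename (R := k) (Sum.inl : τ → τ ⊕ υ))) :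
    setVariableOne I j f = 0 := by
  revert f
  change I.map _ ≤ RingHom.ker (setVariableOne I j)
  rw [Ideal.map_le_iff_le_comap]
  intro g hg
  rw [Ideal.mem_comap, RingHom.mem_ker, setVariableOne_rename_inl,
    Ideal.Quotient.eq_zero_iff_mem.mpr hg, map_zero]

variable {J : HomogeneousIdeal (homogeneousSubmodule (τ ⊕ υ) k)}

/-- Division by `X (.inr j)` kills `J`, hence `I`, and sends that variable to `1`, so it descends to
the chart ring `(k[x]/I)[z_i : i ≠ j]`. -/
theorem exists_ringHom_comp_setVariableOne_eq_divVariable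
    {I : Ideal (MvPolynomial τ k)} (hJ : J.toIdeal = I.map (rename (R := k) Sum.inl))
    (p : Ideal (MvPolynomial (τ ⊕ υ) k ⧸ J.toIdeal)) [p.IsPrime] {j : υ}
    (hj : Ideal.Quotient.mk J.toIdeal (X (.inr j)) ∉ p) :
    ∃ φ : MvPolynomial {i : υ // i ≠ j} (MvPolynomial τ k ⧸ I) →+* HomogeneousLocalization.AtPrime
        (quotientGrading (homogeneousSubmodule (τ ⊕ υ) k) J) p,
      ∀ f, φ (setVariableOne I j f) = divVariable hj f := by
  let ψ := Ideal.Quotient.lift I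
    ((divVariable hj).comp (rename (R := k) Sum.inl).toRingHom) fun g hg =>
      divVariable_eq_zero hj (hJ ▸ Ideal.mem_map_of_mem _ hg)
  let φ := eval₂Hom ψ fun i : {i : υ // i ≠ j} => divVariable hj (X (.inr i.1))
  have hφ : ∀ g, φ (setVariableOne I j (rename Sum.inl g)) = divVariable hj (rename Sum.inl g) := by
    intro g
    rw [setVariableOne_rename_inl, eval₂Hom_C]
    rfl
  refine ⟨φ, fun f => ?_⟩
  suffices h : φ.comp (setVariableOne I j).toRingHom = divVariable hj from DFunLike.congr_fun h f
  refine ringHom_ext (fun r => ?_) fun i => ?_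
  · have := hφ (C r)
    rwa [rename_C] at this
  · change φ (setVariableOne I j (X i)) = _
    rcases i with i | i
    · have := hφ (X i)
      rwa [rename_X] at this
    · by_cases h : i = j
      · subst h
        rw [setVariableOne_X_self, divVariable_X_self, map_one]
      · rw [setVariableOne_X_of_ne I h]
        exact eval₂Hom_X' _ _ _

theorem hasRegularParameters_and_isNoetherianRing_homogeneousLocalization [Finite τ] [Finite υ]
    {I : Ideal (MvPolynomial τ k)} (hJ : J.toIdeal = I.map (rename (R := k) Sum.inl))
    (hI : HasRegularParametersAtPrimes (MvPolynomial τ k ⧸ I))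
    (p : Ideal (MvPolynomial (τ ⊕ υ) k ⧸ J.toIdeal)) [p.IsPrime] {j : υ}
    (hj : Ideal.Quotient.mk J.toIdeal (X (.inr j)) ∉ p) :
    HasRegularParameters
      (HomogeneousLocalization.AtPrime (quotientGrading (homogeneousSubmodule (τ ⊕ υ) k) J) p) ∧
    IsNoetherianRing
      (HomogeneousLocalization.AtPrime (quotientGrading (homogeneousSubmodule (τ ⊕ υ) k) J) p) := by
  obtain ⟨φ, hφ⟩ := exists_ringHom_comp_setVariableOne_eq_divVariable hJ p hj
  let := φ.toAlgebra
  let F : MvPolynomial (τ ⊕ υ) k ⧸ J.toIdeal →+*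
      MvPolynomial {i : υ // i ≠ j} (MvPolynomial τ k ⧸ I) :=
    Ideal.Quotient.lift J.toIdeal (setVariableOne I j).toRingHom
      fun f hf => setVariableOne_eq_zero j (hJ ▸ hf)
  have hloc := HomogeneousLocalization.isLocalization_atPrime_of_dehomogenization
    (mk_mem_quotientGrading (J := J) (isHomogeneous_X k (Sum.inr j))) hj
    (C := MvPolynomial {i : υ // i ≠ j} (MvPolynomial τ k ⧸ I)) F
    (Ideal.Quotient.lift_surjective_of_surjective _ _ (setVariableOne_surjective I j))
    (setVariableOne_X_self I j) (by
      rintro d _ ⟨f, hf, rfl⟩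
      refine Eq.trans ?_ (val_divVariable hj hf)
      rw [← hφ]
      rfl)
  exact ⟨(hI.mvPolynomial {i : υ // i ≠ j}).of_isLocalization ((maximalIdeal _).comap φ) _,
    IsLocalization.isNoetherianRing ((maximalIdeal _).comap φ).primeCompl _ inferInstance⟩

end Stalks

/-! ### Points of the subscheme and the equivalence -/

section Main

variable {k : Type u} [Field k]

theorem isHomogeneous_map_mk_span_X_image {σ : Type}
    (J : HomogeneousIdeal (homogeneousSubmodule σ k)) (Z : Set σ) :
    ((Ideal.span (X '' Z : Set (MvPolynomial σ k))).map
      (Ideal.Quotient.mk J.toIdeal)).IsHomogeneous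
      (quotientGrading (homogeneousSubmodule σ k) J) := by
  rw [Ideal.map_span]
  refine Ideal.homogeneous_span _ _ ?_
  rintro _ ⟨_, ⟨w, _, rfl⟩, rfl⟩
  exact ⟨1, mk_mem_quotientGrading (isHomogeneous_X k w)⟩

/-- The stalk of a projective subscheme at a point is the homogeneous localization at the
corresponding prime ideal. -/
noncomputable def projSubschemeStalkEquiv {σ : Type}
    (J : HomogeneousIdeal (homogeneousSubmodule σ k))
    (x : ProjectiveSpectrum (quotientGrading (homogeneousSubmodule σ k) J)) :
    (projSubscheme J).presheaf.stalk (id x : projSubscheme J) ≃+*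
      HomogeneousLocalization.AtPrime (quotientGrading (homogeneousSubmodule σ k) J)
        x.asHomogeneousIdeal.toIdeal :=
  (Proj.stalkIso (quotientGrading (homogeneousSubmodule σ k) J) x).commRingCatIsoToRingEquiv

theorem localDepth_le_of_ringEquiv {R S : Type u} [CommRing R] [CommRing S] [IsLocalRing R]
    [IsLocalRing S] (e : R ≃+* S) : localDepth R ≤ localDepth S := by
  refine iSup₂_le fun rs hrs => ?_
  let := e.toRingHom.toAlgebra
  have : Module.Flat R S := Module.Flat.of_linearEquiv
    (AlgEquiv.ofRingEquiv (f := e) (fun _ => rfl) : R ≃ₐ[R] S).symm.toLinearEquiv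
  have hmem : ∀ s ∈ rs.map (algebraMap R S), s ∈ maximalIdeal S := by
    intro s hs
    obtain ⟨r, hr, rfl⟩ := List.mem_map.mp hs
    have hr' := hrs.1 r hr
    rw [mem_maximalIdeal, mem_nonunits_iff] at hr' ⊢
    exact fun h => hr' ((MulEquiv.isUnit_map e).mp h)
  refine le_iSup₂_of_le (f := fun (ss : List S) (_ : (∀ r ∈ ss, r ∈ maximalIdeal S) ∧
    RingTheory.Sequence.IsRegular S ss) => (ss.length : ℕ∞)) (rs.map (algebraMap R S))
    ⟨hmem, (IsLocalRing.isRegular_iff_isWeaklyRegular_of_subset_maximalIdeal hmem).mpr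
      hrs.2.toIsWeaklyRegular.of_flat⟩ ?_
  simp

theorem localDepth_eq_of_ringEquiv {R S : Type u} [CommRing R] [CommRing S] [IsLocalRing R]
    [IsLocalRing S] (e : R ≃+* S) : localDepth R = localDepth S :=
  (localDepth_le_of_ringEquiv e).antisymm (localDepth_le_of_ringEquiv e.symm)

/-- A prime containing the classes of all variables would contain the irrelevant ideal. -/
theorem exists_mk_X_notMem {σ : Type} (J : HomogeneousIdeal (homogeneousSubmodule σ k))
    (x : ProjectiveSpectrum (quotientGrading (homogeneousSubmodule σ k) J)) :
    ∃ v, Ideal.Quotient.mk J.toIdeal (X v) ∉ x.asHomogeneousIdeal.toIdeal := by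
  classical
  by_contra! hcon
  refine x.not_irrelevant_le fun a ha => ?_
  obtain ⟨f, rfl⟩ := Ideal.Quotient.mk_surjective a
  rw [HomogeneousIdeal.mem_irrelevant_iff] at ha
  have h0 : Ideal.Quotient.mk J.toIdeal (homogeneousComponent 0 f) = 0 := by
    rw [GradedRing.proj_apply] at ha
    rw [← MvPolynomial.decomposition.decompose'_apply]
    exact (quotientDecomposeAux_apply (homogeneousSubmodule σ k) J f 0).symm.trans ha
  have hspan : f - C (coeff 0 f) ∈ Ideal.span (X '' Set.univ) := by
    rw [mem_ideal_span_X_image]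
    intro e he
    by_contra! hcon
    have : e = 0 := Finsupp.ext fun i => hcon i trivial
    simp [this] at he
  have hle : Ideal.span (X '' Set.univ) ≤
      x.asHomogeneousIdeal.toIdeal.comap (Ideal.Quotient.mk J.toIdeal) := by
    rw [Ideal.span_le]
    rintro _ ⟨v, _, rfl⟩
    exact hcon v
  have := hle hspan
  rwa [Ideal.mem_comap, map_sub, ← homogeneousComponent_zero, h0, sub_zero] at this

/-- The point is the associated prime `J : e`, with `w` the class of the monomial `e`, `a` the
variable whose cancellation fails, and `t` a variable outside the prime. -/
theorem exists_associated_prime_of_not_forall {τ υ : Type} [Finite τ] [Finite υ]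
    {J : HomogeneousIdeal (homogeneousSubmodule (τ ⊕ υ) k)} (hmon : IsMonomialIdeal J.toIdeal)
    (hsat : IsSaturatedIdeal J.toIdeal)
    (hrad : J.toIdeal.radical = Ideal.span (Set.range fun i : τ => X (Sum.inl i)))
    (h : ¬ ∀ (j : υ) (d : τ ⊕ υ →₀ ℕ), monomial (d + Finsupp.single (.inr j) 1) (1 : k) ∈ J.toIdeal →
      monomial d (1 : k) ∈ J.toIdeal) :
    ∃ (x : ProjectiveSpectrum (quotientGrading (homogeneousSubmodule (τ ⊕ υ) k) J))
      (t a w : MvPolynomial (τ ⊕ υ) k ⧸ J.toIdeal) (d : ℕ),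
      t ∈ quotientGrading (homogeneousSubmodule (τ ⊕ υ) k) J 1 ∧
      a ∈ quotientGrading (homogeneousSubmodule (τ ⊕ υ) k) J 1 ∧
      w ∈ quotientGrading (homogeneousSubmodule (τ ⊕ υ) k) J d ∧
      t ∉ x.asHomogeneousIdeal.toIdeal ∧ a ∈ x.asHomogeneousIdeal.toIdeal ∧
      (∀ b, b * w = 0 ↔ b ∈ x.asHomogeneousIdeal.toIdeal) ∧
      ¬ ∃ c ∉ x.asHomogeneousIdeal.toIdeal, ∃ N : ℕ, c * a ^ N = 0 := by
  push Not at h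
  obtain ⟨v, d, hd, hd'⟩ := h
  obtain ⟨Z, e, he, hvZ, hZ⟩ := hmon.exists_colon_eq_span_X hd' hd
  have hprime := isPrime_span_X_image k Z
  have hJZ : J.toIdeal ≤ Ideal.span (X '' Z) := fun f hf => (hZ f).mp (J.toIdeal.mul_mem_right _ hf)
  have hradZ : J.toIdeal.radical ≤ Ideal.span (X '' Z) := hprime.radical_le_iff.mpr hJZ
  -- If all variables multiplied `e` into `J`, saturation with exponent `1` would put `e` in `J`.
  obtain ⟨j, hj⟩ : ∃ j, j ∉ Z := by
    by_contra! hcon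
    refine he (hsat _ ⟨1, fun g hg => (hZ g).mpr ?_⟩)
    rw [pow_one] at hg
    rwa [Set.eq_univ_of_forall hcon, Set.image_univ]
  have hjX : (X j : MvPolynomial (τ ⊕ υ) k) ∉ Ideal.span (X '' Z) := by
    rw [mem_ideal_span_X_image]
    intro hcon
    obtain ⟨i, hi, hi'⟩ := hcon (Finsupp.single j 1) (by simp)
    rw [Finsupp.single_apply_ne_zero] at hi'
    exact hj (hi'.1 ▸ hi)
  have hker : RingHom.ker (Ideal.Quotient.mk J.toIdeal) ≤ Ideal.span (X '' Z) := by
    rwa [Ideal.mk_ker]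
  have hmem : ∀ f : MvPolynomial (τ ⊕ υ) k, Ideal.Quotient.mk J.toIdeal f ∈
      (Ideal.span (X '' Z)).map (Ideal.Quotient.mk J.toIdeal) ↔ f ∈ Ideal.span (X '' Z) := by
    intro f
    rw [← Ideal.mem_comap, Ideal.comap_map_of_surjective' _ Ideal.Quotient.mk_surjective,
      sup_eq_left.mpr hker]
  let x : ProjectiveSpectrum (quotientGrading (homogeneousSubmodule (τ ⊕ υ) k) J) :=
    { asHomogeneousIdeal := ⟨_, isHomogeneous_map_mk_span_X_image J Z⟩
      isPrime := Ideal.map_isPrime_of_surjective Ideal.Quotient.mk_surjective hker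
      not_irrelevant_le := fun hle => by
        refine hjX ((hmem _).mp (hle ?_))
        rw [HomogeneousIdeal.mem_irrelevant_iff]
        exact DirectSum.decompose_of_mem_ne _
          (mk_mem_quotientGrading (J := J) (isHomogeneous_X k j)) one_ne_zero }
  refine ⟨x, Ideal.Quotient.mk _ (X j), Ideal.Quotient.mk _ (X (.inr v)),
    Ideal.Quotient.mk _ (monomial e 1), e.degree, mk_mem_quotientGrading (isHomogeneous_X k _),
    mk_mem_quotientGrading (isHomogeneous_X k _),
    mk_mem_quotientGrading (isHomogeneous_monomial _ rfl), fun hx => hjX ((hmem _).mp hx),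
    (hmem _).mpr (Ideal.subset_span ⟨_, hvZ, rfl⟩), fun b => ?_, ?_⟩
  · obtain ⟨f, rfl⟩ := Ideal.Quotient.mk_surjective b
    rw [← map_mul, Ideal.Quotient.eq_zero_iff_mem, hZ]
    exact (hmem f).symm
  · rintro ⟨c, hc, N, hcN⟩
    obtain ⟨f, rfl⟩ := Ideal.Quotient.mk_surjective c
    refine hc ((hmem f).mpr ?_)
    rw [← map_pow, ← map_mul, Ideal.Quotient.eq_zero_iff_mem] at hcN
    have hinl : Set.range (fun i : τ => (X (Sum.inl i) : MvPolynomial (τ ⊕ υ) k)) =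
        X '' Set.range Sum.inl := by
      rw [← Set.range_comp]; rfl
    rw [hinl] at hrad
    have hp := isPrime_span_X_image k (Set.range (Sum.inl : τ → τ ⊕ υ))
    have h1 := Ideal.le_radical hcN
    rw [hrad] at h1
    -- Since `√J` is the prime generated by the first block, either `c` lies in it, hence in the
    -- larger prime of `x`, or the second-block variable `v` does, which is absurd.
    rcases hp.mem_or_mem h1 with h2 | h2
    · rw [← hrad] at h2
      exact hradZ h2
    · exfalso
      have h3 := hp.mem_of_pow_mem _ h2
      rw [mem_ideal_span_X_image] at h3
      obtain ⟨_, ⟨i, rfl⟩, hi'⟩ := h3 (Finsupp.single (.inr v) 1) (by simp)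
      simp at hi'

end Main

theorem lemma2p1 {k : Type u} [Field k] (m n : ℕ)
    (J : HomogeneousIdeal (MvPolynomial.homogeneousSubmodule (Fin m ⊕ Fin (n + 1)) k))
    (hmon : IsMonomialIdeal J.toIdeal)
    (hsat : IsSaturatedIdeal J.toIdeal)
    (hrad : J.toIdeal.radical = linearSubspaceIdeal k m n) :
    [SatisfiesSerre 1 (projSubscheme J),
      IsLocallyCohenMacaulay (projSubscheme J),
      IsArithmeticallyCohenMacaulay J].TFAE := by
  have cone : (∀ (j : Fin (n + 1)) (d : Fin m ⊕ Fin (n + 1) →₀ ℕ),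
      monomial (d + Finsupp.single (.inr j) 1) (1 : k) ∈ J.toIdeal →
      monomial d (1 : k) ∈ J.toIdeal) →
      IsLocallyCohenMacaulay (projSubscheme J) ∧ IsArithmeticallyCohenMacaulay J := by
    intro h
    have hJ := hmon.eq_map_rename_inl h
    have hXrad : ∀ i, X (Sum.inl i) ∈ J.toIdeal.radical := fun i => by
      rw [hrad]
      exact Ideal.subset_span ⟨i, rfl⟩
    have hI : HasRegularParametersAtPrimes (MvPolynomial (Fin m) k ⧸
        J.toIdeal.comap (rename (R := k) (Sum.inl : Fin m → Fin m ⊕ Fin (n + 1)))) :=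
      .of_le_nilradical (le_nilradical_quotient_of_isPrime fun i => by
        obtain ⟨N, hN⟩ := hXrad i
        exact ⟨N, by rwa [Ideal.mem_comap, map_pow, rename_X]⟩)
    constructor
    · intro y
      let x : ProjectiveSpectrum
        (quotientGrading (homogeneousSubmodule (Fin m ⊕ Fin (n + 1)) k) J) := y
      obtain ⟨v, hv⟩ := exists_mk_X_notMem J x
      -- The variables `x_i` are nilpotent modulo `J`, so they vanish at every point and only the
      -- charts of the `z_j` matter.
      obtain ⟨j, rfl⟩ : ∃ j, v = Sum.inr j := by
        rcases v with i | j
        · refine absurd ?_ hv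
          obtain ⟨N, hN⟩ := hXrad i
          refine x.isPrime.mem_of_pow_mem N ?_
          rw [← map_pow, Ideal.Quotient.eq_zero_iff_mem.mpr hN]
          exact zero_mem _
        · exact ⟨j, rfl⟩
      obtain ⟨h1, h2⟩ := hasRegularParameters_and_isNoetherianRing_homogeneousLocalization hJ hI _ hv
      have := isNoetherianRing_of_ringEquiv _ (projSubschemeStalkEquiv J x).symm
      exact (h1.of_ringEquiv (projSubschemeStalkEquiv J x).symm).isCohenMacaulayLocal
    · exact ((hI.mvPolynomial (Fin (n + 1))).of_ringEquiv
        ((quotientMapRenameInlEquiv _).trans (Ideal.quotEquivOfEq hJ.symm))).isCohenMacaulayRing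
  tfae_have 2 → 1 := fun h x => by
    rw [(h x).2]
    exact min_le_right _ _
  have serre : SatisfiesSerre 1 (projSubscheme J) →
      IsLocallyCohenMacaulay (projSubscheme J) ∧ IsArithmeticallyCohenMacaulay J := fun h => by
    refine cone ?_
    by_contra hcon
    obtain ⟨x, t, a, w, d, ht, ha, hw, htx, hax, hann, hne⟩ :=
      exists_associated_prime_of_not_forall hmon hsat hrad hcon
    refine hne (exists_mul_pow_eq_zero_of_homogeneousLocalization _ ?_ ht htx hw hann ha hax)
    rw [← ringKrullDim_eq_of_ringEquiv (projSubschemeStalkEquiv J x),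
      ← localDepth_eq_of_ringEquiv (projSubschemeStalkEquiv J x)]
    exact h x
  tfae_have 1 → 2 := fun h => (serre h).1
  tfae_have 1 → 3 := fun h => (serre h).2
  -- The embedded prime is excluded directly in `S/J`, so stalks need not be compared with
  -- localizations of `S/J`.
  tfae_have 3 → 2 := fun h => by
    refine (cone ?_).1
    by_contra hcon
    obtain ⟨x, t, a, w, d, ht, ha, hw, htx, hax, hann, hne⟩ :=
      exists_associated_prime_of_not_forall hmon hsat hrad hcon
    exact hne (exists_mul_pow_eq_zero_of_isCohenMacaulayRing h _ hann hax)
  tfae_finish
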